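/- For a monoid $M$ generated by a finite set $A$, the word problem of $M$ with respect to $A$ is the language $\mathrm{WP}(M,A)=\{u\#v^{\mathrm{rev}} : u,v\in A^*,\ u=_M v\}$ over $A\cup\{\#\}$, where $\#\notin A$, $v^{\mathrm{rev}}$ is the reverse of $v$, and $u=_M v$ means that $u$ and $v$ represent the same element of $M$. A context-free cross-section of $M$ is a context-free language, over some finite generating set of $M$, that contains exactly one representative of each element of $M$. There is a monoid that has context-free word problem but admits no context-free cross-section (over any finite generating set). Specifically, let $K=\{a^nb^nc^n : n\ge 0\}$, let $L=\{a,b,c\}^*\setminus K$, let $A=\{a,b,c,x,y,z\}$, and let $M$ be the monoid presented by $\langle A \mid xwy=z\ (w\in L)\rangle$. Then $\mathrm{WP}(M,A)$ is a context-free language, and $M$ admits no context-free cross-section. -/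

import Mathlib

namespace CFWordProblem

universe u v

/-- The element of `M` represented by a word over the alphabet `B`, where each letter `b`
represents the element `f b` of `M`. -/
def eval {B : Type v} {M : Type u} [Monoid M] (f : B → M) (w : List B) : M :=
  (w.map f).prod

/-- The word problem of the monoid `M` with respect to the generators `f : B → M`: the language
of all words `u # v^rev` over the alphabet `B ∪ {#}` with `u, v ∈ B*` representing the same element
of `M`. The alphabet `B ∪ {#}` is `Option B`, with `none` as the new symbol `#`. -/
def wordProblem {B : Type v} {M : Type u} [Monoid M] (f : B → M) : Language (Option B) :=
  {t | ∃ p q : List B, eval f p = eval f q ∧ t = p.map some ++ none :: q.reverse.map some}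

/-- A language over the generators `f : B → M` is a cross-section of `M` if it contains a unique
representative for every element of `M`. -/
def IsCrossSection {B : Type v} {M : Type u} [Monoid M] (f : B → M) (J : Language B) : Prop :=
  ∀ m : M, ∃! w : List B, w ∈ J ∧ eval f w = m

/-- `M` admits a context-free cross-section: for some finite generating set of `M`, a context-free
language over it is a cross-section of `M`. (A finite alphabet lies in `Type` up to renaming of
its letters.) -/
def HasContextFreeCrossSection (M : Type u) [Monoid M] : Prop :=
  ∃ (B : Type) (_ : Finite B) (f : B → M), Submonoid.closure (Set.range f) = ⊤ ∧
    ∃ J : Language B, J.IsContextFree ∧ IsCrossSection f J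

/-- The alphabet `A = {a, b, c, x, y, z}`. -/
inductive Letter : Type
  | a | b | c | x | y | z
  deriving DecidableEq

open Letter

/-- `K = {aⁿ bⁿ cⁿ : n ≥ 0}`. -/
def K : Language Letter :=
  {w | ∃ n : ℕ, w = List.replicate n a ++ List.replicate n b ++ List.replicate n c}

/-- `L = {a, b, c}* − K`. -/
def L : Language Letter :=
  {w | (∀ l ∈ w, l = a ∨ l = b ∨ l = c) ∧ w ∉ K}

/-- The relations `xwy = z` for `w ∈ L`. -/
def rels (p q : FreeMonoid Letter) : Prop :=
  ∃ w ∈ L, p = FreeMonoid.ofList (x :: (w ++ [y])) ∧ q = FreeMonoid.of z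

/-- The monoid with presentation `⟨a, b, c, x, y, z | xwy = z for w ∈ L⟩`. -/
abbrev M : Type := PresentedMonoid rels

end CFWordProblem

/-! Word problem. In the rewriting rules `xwy → z` with `w ∈ L`, the left side has `x` only at its
start and `y` only at its end, and a new `z` can never lie in another left side. So redexes neither
overlap nor nest, and contracting disjoint factors in one pass already gives a normal form
(`reduces_normalForm`). An action of `M` on words shows that equal elements have equal normal forms
(`normalForm_eq_of_eval_eq`). Hence `p = q` in `M` exactly when `p` and `q` reduce to a common word
in this sense. Reading that word from the outside in, one letter at a time, gives a grammar for the
words `p # q^rev` whose only further ingredients are `L` and its reversal. A word of `{a, b, c}*`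
lies in `L` iff it has a descent or is `aⁱbʲcᵏ` with `i ≠ j` or `j ≠ k`, so `L` is context-free;
closure under substitution finishes this half.

Cross-section. For `w ∈ K` the word `xwy` is the only word over `A` for its element
(`eq_of_eval_eq`). Spell each generator of a supposed context-free cross-section `J` over `A`; the
representative `W ∈ J` of `xaⁿbⁿcⁿy` is then spelled exactly so. Pump `W` while preserving the
transition map of an automaton for `x{a,b,c}*y`. The spelling of a pumped word is again some `xry`,
and for large `n` the pumped factor misses `a` or `c`, so that letter still occurs `n` times. If `r
∈ K`, then `r = aⁿbⁿcⁿ`, and uniqueness in `J` makes the pumped word equal to `W`, which its length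
forbids. So `r ∈ L` and the pumped word represents `z`. Pumping down and pumping up thus give two
different words of `J` for `z`. -/

namespace ContextFreeGrammar

/-! ### Derivations as substitution of words for nonterminals -/

/-- Given a set `Y A` of words for every nonterminal `A`, `Expands Y α w` says that `w` arises from
`α` by replacing every occurrence of every nonterminal `A` by a word of `Y A`. -/
inductive Expands {T N : Type*} (Y : N → List T → Prop) : List (Symbol T N) → List T → Prop
  | nil : Expands Y [] []
  | terminal (t : T) {α : List (Symbol T N)} {w : List T} (h : Expands Y α w) :
      Expands Y (Symbol.terminal t :: α) (t :: w)
  | nonterminal {A : N} {v : List T} (hA : Y A v) {α : List (Symbol T N)} {w : List T}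
      (h : Expands Y α w) : Expands Y (Symbol.nonterminal A :: α) (v ++ w)

namespace Expands

variable {T N : Type*} {Y Y' : N → List T → Prop} {α β : List (Symbol T N)} {v w : List T}

lemma mono (hY : ∀ A w, Y A w → Y' A w) (h : Expands Y α w) : Expands Y' α w := by
  induction h with
  | nil => exact .nil
  | terminal t _ ih => exact .terminal t ih
  | nonterminal hA _ ih => exact .nonterminal (hY _ _ hA) ih

@[simp] lemma nil_iff : Expands Y [] w ↔ w = [] :=
  ⟨fun h => by cases h; rfl, fun h => h ▸ .nil⟩

@[simp] lemma terminal_cons_iff {t : T} :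
    Expands Y (Symbol.terminal t :: α) w ↔ ∃ w', Expands Y α w' ∧ w = t :: w' :=
  ⟨fun h => by cases h with | terminal _ h => exact ⟨_, h, rfl⟩,
    fun ⟨_, h, e⟩ => e ▸ .terminal t h⟩

@[simp] lemma nonterminal_cons_iff {A : N} :
    Expands Y (Symbol.nonterminal A :: α) w ↔
      ∃ v, Y A v ∧ ∃ w', Expands Y α w' ∧ w = v ++ w' :=
  ⟨fun h => by cases h with | nonterminal hA h => exact ⟨_, hA, _, h, rfl⟩,
    fun ⟨_, hA, _, h, e⟩ => e ▸ .nonterminal hA h⟩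

lemma append (h : Expands Y α v) (h' : Expands Y β w) : Expands Y (α ++ β) (v ++ w) := by
  induction h with
  | nil => exact h'
  | terminal t _ ih => exact .terminal t ih
  | nonterminal hA _ ih => rw [List.append_assoc]; exact .nonterminal hA ih

lemma append_iff : Expands Y (α ++ β) w ↔
    ∃ w₁ w₂, w = w₁ ++ w₂ ∧ Expands Y α w₁ ∧ Expands Y β w₂ := by
  refine ⟨fun h => ?_, fun ⟨w₁, w₂, e, h₁, h₂⟩ => e ▸ h₁.append h₂⟩
  induction α generalizing w with
  | nil => exact ⟨[], w, rfl, .nil, h⟩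
  | cons s α ih =>
    cases h with
    | terminal t h =>
      obtain ⟨w₁, w₂, rfl, h₁, h₂⟩ := ih h
      exact ⟨t :: w₁, w₂, rfl, .terminal t h₁, h₂⟩
    | nonterminal hA h =>
      obtain ⟨w₁, w₂, rfl, h₁, h₂⟩ := ih h
      exact ⟨_ ++ w₁, w₂, (List.append_assoc ..).symm, .nonterminal hA h₁, h₂⟩

lemma map_terminal_iff : Expands Y (v.map Symbol.terminal) w ↔ w = v := by
  induction v generalizing w with
  | nil => simp
  | cons t v ih => simp [ih]

lemma length_le {b : ℕ} (hb : 1 ≤ b) (hY : ∀ A w, Y A w → w.length ≤ b) (h : Expands Y α w) :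
    w.length ≤ α.length * b := by
  induction h with
  | nil => simp
  | terminal t _ ih => simp only [List.length_cons, add_mul]; omega
  | nonterminal hA _ ih =>
    have := hY _ _ hA
    simp only [List.length_cons, List.length_append, add_mul]; omega

lemma exists_of_not (h : Expands Y α w) (h' : ¬ Expands Y' α w) :
    ∃ A v α₁ α₂ w₁ w₂, Y A v ∧ ¬ Y' A v ∧ α = α₁ ++ Symbol.nonterminal A :: α₂ ∧
      w = w₁ ++ v ++ w₂ ∧ Expands Y α₁ w₁ ∧ Expands Y α₂ w₂ := by
  induction h with
  | nil => exact absurd .nil h'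
  | terminal t _ ih =>
    obtain ⟨A, v, α₁, α₂, w₁, w₂, h₁, h₂, rfl, rfl, h₃, h₄⟩ := ih fun h => h' (.terminal t h)
    exact ⟨A, v, _, α₂, t :: w₁, w₂, h₁, h₂, rfl, rfl, .terminal t h₃, h₄⟩
  | @nonterminal A v hA α w h ih =>
    by_cases hA' : Y' A v
    · obtain ⟨B, u, α₁, α₂, w₁, w₂, h₁, h₂, rfl, rfl, h₃, h₄⟩ := ih fun h => h' (.nonterminal hA' h)
      exact ⟨B, u, _, α₂, v ++ w₁, w₂, h₁, h₂, rfl, by simp, .nonterminal hA h₃, h₄⟩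
    · exact ⟨A, v, [], α, [], w, hA, hA', rfl, rfl, .nil, h⟩

end Expands

section Yields

variable {T : Type*} (g : ContextFreeGrammar T)

/-- The word `w` can be derived from the nonterminal `A`. -/
def Yields (A : g.NT) (w : List T) : Prop :=
  g.Derives [Symbol.nonterminal A] (w.map Symbol.terminal)

variable {g} {α β : List (Symbol T g.NT)} {w : List T}

lemma Expands.derives (h : Expands g.Yields α w) : g.Derives α (w.map Symbol.terminal) := by
  induction h with
  | nil => exact Relation.ReflTransGen.refl
  | terminal t _ ih => simpa using ih.append_left [Symbol.terminal t]
  | @nonterminal A v hA α w h ih =>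
    simpa using (Derives.append_right hA α).trans (ih.append_left (v.map Symbol.terminal))

/-- The derivable words form the least family of languages that is closed under the rules. -/
lemma Derives.expands {Y : g.NT → List T → Prop}
    (hY : ∀ r ∈ g.rules, ∀ w, Expands Y r.output w → Y r.input w)
    (h : g.Derives α (w.map Symbol.terminal)) : Expands Y α w := by
  induction h using Relation.ReflTransGen.head_induction_on with
  | refl => exact Expands.map_terminal_iff.2 rfl
  | head h _ ih =>
    obtain ⟨r, hr, h⟩ := h
    obtain ⟨p, q, rfl, rfl⟩ := h.exists_parts
    obtain ⟨w₁, w₂, rfl, h₁, h₂⟩ := Expands.append_iff.1 ih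
    obtain ⟨w₁, w₃, rfl, h₁, h₃⟩ := Expands.append_iff.1 h₁
    have h₄ : Expands Y [Symbol.nonterminal r.input] w₃ := by simpa using hY r hr _ h₃
    exact (h₁.append h₄).append h₂

lemma Yields.induction {Y : g.NT → List T → Prop}
    (hY : ∀ r ∈ g.rules, ∀ w, Expands Y r.output w → Y r.input w)
    {A : g.NT} (h : g.Yields A w) : Y A w := by
  simpa using Derives.expands hY h

lemma derives_of_mem_rules {r : ContextFreeRule T g.NT} (hr : r ∈ g.rules) :
    g.Derives [Symbol.nonterminal r.input] r.output :=
  Produces.single ⟨r, hr, ContextFreeRule.Rewrites.input_output⟩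

lemma Yields.of_expands {r : ContextFreeRule T g.NT} (hr : r ∈ g.rules)
    (h : Expands g.Yields r.output w) : g.Yields r.input w :=
  (derives_of_mem_rules hr).trans h.derives

end Yields

/-! ### Derivation trees and a pumping lemma with a finite invariant -/

section Pumping

variable {T : Type*} (g : ContextFreeGrammar T)

/-- The word `w` has a derivation tree of height at most `k` with root `A`. -/
def HeightLE : ℕ → g.NT → List T → Prop
  | 0, _, _ => False
  | k + 1, A, w => ∃ r ∈ g.rules, r.input = A ∧ Expands (HeightLE k) r.output w

variable {g}

lemma HeightLE.succ {k : ℕ} {A : g.NT} {w : List T} (h : g.HeightLE k A w) :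
    g.HeightLE (k + 1) A w := by
  induction k generalizing A w with
  | zero => exact h.elim
  | succ k ih =>
    obtain ⟨r, hr, e, h⟩ := h
    exact ⟨r, hr, e, h.mono fun _ _ => ih⟩

lemma HeightLE.mono {k l : ℕ} (hkl : k ≤ l) {A : g.NT} {w : List T} (h : g.HeightLE k A w) :
    g.HeightLE l A w := by
  induction hkl with
  | refl => exact h
  | step _ ih => exact ih.succ

lemma HeightLE.yields {k : ℕ} {A : g.NT} {w : List T} (h : g.HeightLE k A w) : g.Yields A w := by
  induction k generalizing A w with
  | zero => exact h.elim
  | succ k ih =>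
    obtain ⟨r, hr, rfl, h⟩ := h
    exact Yields.of_expands hr (h.mono fun _ _ => ih)

lemma exists_expands_heightLE {α : List (Symbol T g.NT)} {w : List T}
    (h : Expands (fun A w => ∃ k, g.HeightLE k A w) α w) : ∃ k, Expands (g.HeightLE k) α w := by
  induction h with
  | nil => exact ⟨0, .nil⟩
  | terminal t _ ih => exact ih.imp fun _ h => .terminal t h
  | nonterminal hA _ ih =>
    obtain ⟨k, hk⟩ := hA
    obtain ⟨l, hl⟩ := ih
    exact ⟨max k l, .nonterminal (hk.mono (le_max_left ..))
      (hl.mono fun _ _ h => h.mono (le_max_right ..))⟩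

lemma Yields.exists_heightLE {A : g.NT} {w : List T} (h : g.Yields A w) :
    ∃ k, g.HeightLE k A w := by
  refine Yields.induction (Y := fun A w => ∃ k, g.HeightLE k A w) (fun r hr w h => ?_) h
  obtain ⟨k, hk⟩ := exists_expands_heightLE h
  exact ⟨k + 1, r, hr, rfl, hk⟩

lemma HeightLE.length_le {m : ℕ} (hm : 1 ≤ m) (hg : ∀ r ∈ g.rules, r.output.length ≤ m)
    {k : ℕ} {A : g.NT} {w : List T} (h : g.HeightLE k A w) : w.length ≤ m ^ k := by
  induction k generalizing A w with
  | zero => exact h.elim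
  | succ k ih =>
    obtain ⟨r, hr, -, h⟩ := h
    calc w.length ≤ r.output.length * m ^ k := h.length_le (Nat.one_le_pow _ _ hm) fun _ _ => ih
      _ ≤ m * m ^ k := Nat.mul_le_mul_right _ (hg r hr)
      _ = m ^ (k + 1) := (pow_succ' m k).symm

variable (g) in
/-- `w` is derived from `A` through a sentential form in which only a nonterminal `A'` is left,
which is then expanded to `w'`. -/
def Context (c c' : g.NT × List T) : Prop :=
  ∃ u t, c.2 = u ++ c'.2 ++ t ∧ g.Derives [Symbol.nonterminal c.1]
    (u.map Symbol.terminal ++ [Symbol.nonterminal c'.1] ++ t.map Symbol.terminal)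

lemma Context.refl (c : g.NT × List T) : g.Context c c :=
  ⟨[], [], by simp, by simpa using Relation.ReflTransGen.refl⟩

lemma Context.trans {c c' c'' : g.NT × List T} (h : g.Context c c') (h' : g.Context c' c'') :
    g.Context c c'' := by
  obtain ⟨u, t, e, h⟩ := h
  obtain ⟨u', t', e', h'⟩ := h'
  refine ⟨u ++ u', t' ++ t, by simp [e, e'], h.trans ?_⟩
  simpa using (h'.append_left (u.map Symbol.terminal)).append_right (t.map Symbol.terminal)

variable (g) in
/-- The least height of a derivation tree for `w` with root `A` is `k + 1`. -/
def HeightEq (k : ℕ) (c : g.NT × List T) : Prop :=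
  g.HeightLE (k + 1) c.1 c.2 ∧ ¬ g.HeightLE k c.1 c.2

/-- If all subtrees below the root could be chosen of height at most `k`, the whole tree would have
height at most `k + 1`. So some child has least height exactly `k + 1`, and its siblings supply the
surrounding words. -/
lemma HeightEq.exists_context {k : ℕ} {c : g.NT × List T} (h : g.HeightEq (k + 1) c) :
    ∃ c', g.HeightEq k c' ∧ g.Context c c' := by
  obtain ⟨⟨r, hr, e, h⟩, h'⟩ := h
  obtain ⟨A, v, α₁, α₂, w₁, w₂, hv, hv', e₁, e₂, h₁, h₂⟩ :=
    h.exists_of_not (Y' := g.HeightLE k) fun h => h' ⟨r, hr, e, h⟩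
  refine ⟨(A, v), ⟨hv, hv'⟩, w₁, w₂, e₂, ?_⟩
  rw [← e]
  refine (derives_of_mem_rules hr).trans ?_
  rw [e₁, List.append_cons]
  exact (((h₁.mono fun _ _ => HeightLE.yields).derives.append_right _).append_right _).trans
    ((h₂.mono fun _ _ => HeightLE.yields).derives.append_left _)

/-- A path down the tree, indexed from the bottom, along which the least height drops by exactly one
at each node. -/
lemma HeightEq.exists_chain {K : ℕ} {c : g.NT × List T} (h : g.HeightEq K c) :
    ∃ f : ℕ → g.NT × List T, f K = c ∧ (∀ j ≤ K, g.HeightEq j (f j)) ∧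
      ∀ j ≤ K, ∀ i ≤ j, g.Context (f j) (f i) := by
  induction K generalizing c with
  | zero =>
    refine ⟨fun _ => c, rfl, fun j hj => ?_, fun _ _ _ _ => .refl c⟩
    rwa [Nat.le_zero.1 hj]
  | succ K ih =>
    obtain ⟨c', hc', hcc'⟩ := h.exists_context
    obtain ⟨f, e, hf, hf'⟩ := ih hc'
    refine ⟨Function.update f (K + 1) c, by simp, fun j hj => ?_, fun j hj i hij => ?_⟩
    · rcases Nat.le_succ_iff.1 hj with hj | rfl
      · rw [Function.update_of_ne (by omega)]; exact hf j hj
      · rwa [Function.update_self]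
    · rcases Nat.le_succ_iff.1 hj with hj | rfl
      · rw [Function.update_of_ne (by omega), Function.update_of_ne (by omega)]
        exact hf' j hj i hij
      · rcases Nat.le_succ_iff.1 hij with hi | rfl
        · rw [Function.update_self, Function.update_of_ne (by omega)]
          exact hcc'.trans (e ▸ hf' K le_rfl i hi)
        · exact .refl _

lemma derives_replicate {A : g.NT} {v s : List T}
    (h : g.Derives [Symbol.nonterminal A]
      (v.map Symbol.terminal ++ [Symbol.nonterminal A] ++ s.map Symbol.terminal)) (i : ℕ) :
    g.Derives [Symbol.nonterminal A]
      ((List.replicate i v).flatten.map Symbol.terminal ++ [Symbol.nonterminal A] ++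
        (List.replicate i s).flatten.map Symbol.terminal) := by
  induction i with
  | zero => simpa using Relation.ReflTransGen.refl
  | succ i ih =>
    refine h.trans ?_
    rw [List.replicate_succ, List.replicate_succ']
    simpa using (ih.append_left (v.map Symbol.terminal)).append_right (s.map Symbol.terminal)

/-- The pumping lemma, refined by a finite invariant `θ` of words: the pumped part can be chosen so
that `θ` does not distinguish the factor with one copy of it from the factor with none. -/
theorem pumping_lemma (g : ContextFreeGrammar T) {F : Type*} [Finite F] (θ : List T → F) :
    ∃ p : ℕ, ∀ W ∈ g.language, p < W.length → ∃ u v w s t : List T,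
      W = u ++ (v ++ w ++ s) ++ t ∧ v ++ s ≠ [] ∧ (v ++ w ++ s).length ≤ p ∧
      θ (v ++ w ++ s) = θ w ∧
      ∀ i : ℕ, u ++ ((List.replicate i v).flatten ++ w ++ (List.replicate i s).flatten) ++ t ∈
        g.language := by
  classical
  have := Fintype.ofFinite F
  -- `g.NT` may be infinite, but every node of a derivation tree is labelled by the input of a rule.
  set I := g.rules.image ContextFreeRule.input with hI
  set m := g.rules.sup (fun r => r.output.length) + 1 with hm
  set P := Fintype.card (I × F) with hP
  have hlen : ∀ {k : ℕ} {A : g.NT} {w : List T}, g.HeightLE k A w → w.length ≤ m ^ k :=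
    fun h => h.length_le (by omega) fun r hr =>
      (Finset.le_sup (f := fun r => r.output.length) hr).trans (Nat.le_succ _)
  refine ⟨m ^ (P + 1), fun W hW hlt => ?_⟩
  have hW' := Yields.exists_heightLE (A := g.initial) hW
  obtain ⟨K, hK⟩ : ∃ K, g.HeightEq K (g.initial, W) := by
    have hspec := Nat.find_spec hW'
    rcases hn : Nat.find hW' with _ | K
    · rw [hn] at hspec
      exact hspec.elim
    · rw [hn] at hspec
      exact ⟨K, hspec, Nat.find_min hW' (by omega)⟩
  have hPK : P ≤ K := by
    by_contra! h
    have := hlen (hK.1.mono (show K + 1 ≤ P + 1 by omega))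
    exact absurd hlt (by simpa using this)
  obtain ⟨f, e, hf, hf'⟩ := hK.exists_chain
  have hmem : ∀ j : Fin (P + 1), (f j).1 ∈ I := fun j => by
    obtain ⟨⟨r, hr, e, -⟩, -⟩ := hf j (by omega)
    exact Finset.mem_image.2 ⟨r, hr, e⟩
  -- Pigeonhole on the lowest `P + 1` nodes of the path, so that the upper of the two has a yield of
  -- length at most `m ^ (P + 1)`.
  obtain ⟨i, j, hij, hφ⟩ : ∃ i j : Fin (P + 1), i < j ∧
      ((⟨(f i).1, hmem i⟩, θ (f i).2) : I × F) = (⟨(f j).1, hmem j⟩, θ (f j).2) := by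
    obtain ⟨i, j, hne, h⟩ := Fintype.exists_ne_map_eq_of_card_lt
      (fun j : Fin (P + 1) => ((⟨(f j).1, hmem j⟩, θ (f j).2) : I × F)) (by simp [hP])
    rcases lt_or_gt_of_ne hne with hlt | hlt
    · exact ⟨i, j, hlt, h⟩
    · exact ⟨j, i, hlt, h.symm⟩
  simp only [Prod.mk.injEq, Subtype.mk.injEq] at hφ
  have hi := hf i (by omega)
  have hj := hf j (by omega)
  obtain ⟨u, t, e₁, h₁⟩ := hf' K le_rfl j (by omega)
  obtain ⟨v, s, e₂, h₂⟩ := hf' j (by omega) i (by omega)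
  rw [hφ.1] at h₂
  rw [e] at e₁ h₁
  refine ⟨u, v, (f i).2, s, t, e₂ ▸ e₁, fun h => ?_, ?_, e₂ ▸ hφ.2.symm, fun n => ?_⟩
  · obtain ⟨rfl, rfl⟩ := List.append_eq_nil_iff.1 h
    -- With nothing to pump, the two nodes would have the same label and yield, although their least
    -- heights differ.
    have : f i = f j := Prod.ext hφ.1 (by simpa using e₂.symm)
    exact hj.2 (this ▸ hi.1.mono (by omega))
  · rw [← e₂]; exact hlen (hj.1.mono (by omega))
  · rw [mem_language_iff]
    have h₃ : g.Derives [Symbol.nonterminal (f j).1] ((f i).2.map Symbol.terminal) :=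
      hφ.1 ▸ hi.1.yields
    refine h₁.trans ?_
    have h₄ := (derives_replicate h₂ n).trans
      ((h₃.append_left ((List.replicate n v).flatten.map Symbol.terminal)).append_right _)
    simpa using (h₄.append_left (u.map Symbol.terminal)).append_right (t.map Symbol.terminal)

end Pumping

end ContextFreeGrammar

/-! ### Closure under substitution -/

namespace Language

open ContextFreeGrammar

/-- Context-free languages are closed under substitution of context-free languages for letters. -/
theorem IsContextFree.subst {S : Type} {T : Type*} [Finite S] {L : Language S}
    (hL : L.IsContextFree) {σ : S → Language T} (hσ : ∀ s, (σ s).IsContextFree) :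
    IsContextFree ({w | ∃ v ∈ L, w ∈ (v.map σ).prod} : Language T) := by
  classical
  have := Fintype.ofFinite S
  obtain ⟨g, rfl⟩ := hL
  choose G hG using hσ
  let φ : Symbol S g.NT → Symbol T (g.NT ⊕ Σ s, (G s).NT)
    | .terminal s => .nonterminal (.inr ⟨s, (G s).initial⟩)
    | .nonterminal A => .nonterminal (.inl A)
  let ψ (s : S) : Symbol T (G s).NT → Symbol T (g.NT ⊕ Σ s, (G s).NT)
    | .terminal t => .terminal t
    | .nonterminal A => .nonterminal (.inr ⟨s, A⟩)
  let H : ContextFreeGrammar T :=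
    { NT := g.NT ⊕ Σ s, (G s).NT
      initial := .inl g.initial
      rules := g.rules.image (fun r => ⟨.inl r.input, r.output.map φ⟩) ∪
        Finset.univ.biUnion fun s =>
          (G s).rules.image fun r => ⟨.inr ⟨s, r.input⟩, r.output.map (ψ s)⟩ }
  have hr₁ : ∀ r ∈ g.rules, (⟨.inl r.input, r.output.map φ⟩ : ContextFreeRule T H.NT) ∈ H.rules :=
    fun r hr => Finset.mem_union_left _ (Finset.mem_image_of_mem _ hr)
  have hr₂ : ∀ s, ∀ r ∈ (G s).rules,
      (⟨.inr ⟨s, r.input⟩, r.output.map (ψ s)⟩ : ContextFreeRule T H.NT) ∈ H.rules :=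
    fun s r hr => Finset.mem_union_right _
      (Finset.mem_biUnion.2 ⟨s, Finset.mem_univ s, Finset.mem_image_of_mem _ hr⟩)
  have hψ : ∀ (s : S) (Y : H.NT → List T → Prop) (α : List (Symbol T (G s).NT)) (w : List T),
      Expands Y (α.map (ψ s)) w ↔ Expands (fun A => Y (.inr ⟨s, A⟩)) α w := by
    intro s Y α w
    induction α generalizing w with
    | nil => simp
    | cons a α ih => cases a <;> simp [ψ, ih]
  have hφ : ∀ (Y : H.NT → List T → Prop) (Y' : g.NT → List S → Prop)
      (α : List (Symbol S g.NT)) (w : List T),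
      (∀ s w, Y (.inr ⟨s, (G s).initial⟩) w → w ∈ σ s) →
      (∀ A w, Y (.inl A) w → ∃ v, Y' A v ∧ w ∈ (v.map σ).prod) →
      Expands Y (α.map φ) w → ∃ v, Expands Y' α v ∧ w ∈ (v.map σ).prod := by
    intro Y Y' α w h₁ h₂
    induction α generalizing w with
    | nil => intro h; exact ⟨[], .nil, by simpa using h⟩
    | cons a α ih =>
      cases a with
      | terminal s =>
        simp only [List.map_cons, φ, Expands.nonterminal_cons_iff]
        rintro ⟨v, hv, w', h, rfl⟩
        obtain ⟨v', h, hw⟩ := ih _ h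
        exact ⟨s :: v', Expands.terminal s h, by
          simpa using Language.append_mem_mul (h₁ s v hv) hw⟩
      | nonterminal A =>
        simp only [List.map_cons, φ, Expands.nonterminal_cons_iff]
        rintro ⟨v, hv, w', h, rfl⟩
        obtain ⟨v', h, hw⟩ := ih _ h
        obtain ⟨v₁, hv₁, hw₁⟩ := h₂ A v hv
        exact ⟨v₁ ++ v', ⟨v₁, hv₁, v', h, rfl⟩, by
          simpa using Language.append_mem_mul hw₁ hw⟩
  have hφ' : ∀ (Y : H.NT → List T → Prop) (α : List (Symbol S g.NT)) (v : List S) (w : List T),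
      (∀ s, ∀ w ∈ σ s, Y (.inr ⟨s, (G s).initial⟩) w) →
      Expands (fun A v => ∀ w ∈ (v.map σ).prod, Y (.inl A) w) α v →
      w ∈ (v.map σ).prod → Expands Y (α.map φ) w := by
    intro Y α v w h₁ h
    induction h generalizing w with
    | nil => intro h; simpa using h
    | terminal s _ ih =>
      simp only [List.map_cons, List.prod_cons]
      rintro ⟨w₁, hw₁, w₂, hw₂, rfl⟩
      exact .nonterminal (h₁ s w₁ hw₁) (ih _ hw₂)
    | nonterminal hA _ ih =>
      simp only [List.map_append, List.prod_append]
      rintro ⟨w₁, hw₁, w₂, hw₂, rfl⟩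
      exact .nonterminal (hA w₁ hw₁) (ih _ hw₂)
  refine ⟨H, Set.ext fun w => ⟨fun hw => ?_, ?_⟩⟩
  · let Y : H.NT → List T → Prop
      | .inl A, w => ∃ v, g.Yields A v ∧ w ∈ (v.map σ).prod
      | .inr ⟨s, A⟩, w => (G s).Yields A w
    refine Yields.induction (Y := Y) (fun r hr w h => ?_) hw
    rcases Finset.mem_union.1 hr with hr | hr
    · obtain ⟨r, hr', rfl⟩ := Finset.mem_image.1 hr
      obtain ⟨v, hv, hw⟩ := hφ Y g.Yields r.output w (fun s w h => hG s ▸ h) (fun _ _ h => h) h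
      exact ⟨v, Yields.of_expands hr' hv, hw⟩
    · obtain ⟨s, -, hr⟩ := Finset.mem_biUnion.1 hr
      obtain ⟨r, hr', rfl⟩ := Finset.mem_image.1 hr
      exact Yields.of_expands hr' ((hψ s Y _ _).1 h)
  · rintro ⟨v, hv, hw⟩
    have hs : ∀ s, ∀ w ∈ σ s, H.Yields (.inr ⟨s, (G s).initial⟩) w := by
      intro s w hw
      rw [← hG s] at hw
      exact Yields.induction (Y := fun A w => H.Yields (.inr ⟨s, A⟩) w)
        (fun r hr w h => Yields.of_expands (hr₂ s r hr) ((hψ s _ _ _).2 h)) hw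
    exact Yields.induction (Y := fun A v => ∀ w ∈ (v.map σ).prod, H.Yields (.inl A) w)
      (fun r hr v h w hw => Yields.of_expands (hr₁ r hr) (hφ' _ _ _ _ hs h hw)) hv w hw

theorem isContextFree_singleton {T : Type*} (w : List T) :
    IsContextFree ({w} : Language T) := by
  refine ⟨⟨Unit, (), {⟨(), w.map Symbol.terminal⟩}⟩, Set.ext fun v => ⟨fun h => ?_, ?_⟩⟩
  · refine Yields.induction (Y := fun _ v => v = w) (fun r hr v h => ?_) h
    rw [Finset.mem_singleton.1 hr] at h
    exact Expands.map_terminal_iff.1 h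
  · rintro rfl
    exact derives_of_mem_rules (g := ⟨Unit, (), {⟨(), v.map Symbol.terminal⟩}⟩)
      (Finset.mem_singleton_self _)

theorem IsContextFree.map {S : Type} {T : Type*} [Finite S] {L : Language S}
    (hL : L.IsContextFree) (f : S → T) : (Language.map f L).IsContextFree := by
  have h : ∀ (v : List S), (v.map fun s => ({[f s]} : Language T)).prod = {v.map f} := by
    intro v
    induction v with
    | nil => rfl
    | cons s v ih =>
      rw [List.map_cons, List.prod_cons, ih]
      exact Set.image2_singleton
  suffices hmap : Language.map f L =
      ({w | ∃ v ∈ L, w ∈ (v.map fun s => ({[f s]} : Language T)).prod} : Language T) by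
    rw [hmap]
    exact hL.subst fun s => isContextFree_singleton _
  refine Set.ext fun w => ⟨?_, ?_⟩
  · rintro ⟨v, hv, rfl⟩
    exact ⟨v, hv, by rw [h]; rfl⟩
  · rintro ⟨v, hv, hw⟩
    rw [h] at hw
    exact ⟨v, hv, hw.symm⟩

end Language

/-! ### A context-free grammar for `L` -/

namespace CFWordProblem

open Letter ContextFreeGrammar

/-- A letter among `a`, `b`, `c`. -/
def IsABC (l : Letter) : Prop := l = a ∨ l = b ∨ l = c

/-- Nonterminals of a grammar for `L`: words of `L`, words `lⁱ mʲ` with `i ≠ j`, words `lⁿ`, and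
words over `{a, b, c}`. -/
inductive LNonterminal : Type
  | word
  | ne (l m : Letter)
  | star (l : Letter)
  | all
  deriving DecidableEq

/-- The language of each nonterminal of the grammar for `L`. -/
def LNonterminal.Sem : LNonterminal → List Letter → Prop
  | word, w => w ∈ L
  | ne l m, w => ∃ i j, i ≠ j ∧ w = List.replicate i l ++ List.replicate j m
  | star l, w => ∃ i, w = List.replicate i l
  | all, w => ∀ l ∈ w, IsABC l

open LNonterminal in
/-- The rules of a grammar for `L`. -/
def LRules : List (ContextFreeRule Letter LNonterminal) :=
  [⟨word, [.nonterminal all, .terminal b, .terminal a, .nonterminal all]⟩,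
   ⟨word, [.nonterminal all, .terminal c, .terminal a, .nonterminal all]⟩,
   ⟨word, [.nonterminal all, .terminal c, .terminal b, .nonterminal all]⟩,
   ⟨word, [.nonterminal (ne a b), .nonterminal (star c)]⟩,
   ⟨word, [.nonterminal (star a), .nonterminal (ne b c)]⟩,
   ⟨ne a b, [.terminal a, .nonterminal (ne a b), .terminal b]⟩,
   ⟨ne a b, [.terminal a, .nonterminal (star a)]⟩,
   ⟨ne a b, [.terminal b, .nonterminal (star b)]⟩,
   ⟨ne b c, [.terminal b, .nonterminal (ne b c), .terminal c]⟩,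
   ⟨ne b c, [.terminal b, .nonterminal (star b)]⟩,
   ⟨ne b c, [.terminal c, .nonterminal (star c)]⟩,
   ⟨star a, []⟩, ⟨star a, [.terminal a, .nonterminal (star a)]⟩,
   ⟨star b, []⟩, ⟨star b, [.terminal b, .nonterminal (star b)]⟩,
   ⟨star c, []⟩, ⟨star c, [.terminal c, .nonterminal (star c)]⟩,
   ⟨all, []⟩, ⟨all, [.terminal a, .nonterminal all]⟩,
   ⟨all, [.terminal b, .nonterminal all]⟩, ⟨all, [.terminal c, .nonterminal all]⟩]

open Classical in
/-- A grammar for `L`. -/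
noncomputable def LGrammar : ContextFreeGrammar Letter := ⟨LNonterminal, .word, LRules.toFinset⟩

lemma LGrammar.mem_rules {r : ContextFreeRule Letter LNonterminal} :
    r ∈ LGrammar.rules ↔ r ∈ LRules := by
  classical exact List.mem_toFinset

/-- The position of a letter in the order `a < b < c`. -/
def rank : Letter → ℕ
  | a => 0
  | b => 1
  | _ => 2

/-- Words of `K` are sorted by `rank`. -/
lemma notMem_K_of_rank_lt {l m : Letter} (h : rank m < rank l) (p q : List Letter) :
    p ++ l :: m :: q ∉ K := by
  rintro ⟨n, hn⟩
  have : (List.replicate n a ++ List.replicate n b ++ List.replicate n c).Pairwise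
      fun l m => rank l ≤ rank m := by
    simp +contextual [List.pairwise_append, List.pairwise_replicate, rank]
  rw [← hn, List.pairwise_append] at this
  have h' := (List.pairwise_cons.1 this.2.1).1 m (by simp)
  omega

lemma replicate_mem_K_iff {i j k : ℕ} :
    List.replicate i a ++ List.replicate j b ++ List.replicate k c ∈ K ↔ i = j ∧ j = k := by
  constructor
  · rintro ⟨n, hn⟩
    have ha := congrArg (List.count a) hn
    have hb := congrArg (List.count b) hn
    have hc := congrArg (List.count c) hn
    simp [List.count_replicate] at ha hb hc
    omega
  · rintro ⟨rfl, rfl⟩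
    exact ⟨i, rfl⟩

lemma exists_descent_or_eq_replicate {w : List Letter} (hw : ∀ l ∈ w, IsABC l) :
    (∃ p q l m, w = p ++ l :: m :: q ∧ rank m < rank l) ∨
      ∃ i j k, w = List.replicate i a ++ List.replicate j b ++ List.replicate k c := by
  induction w with
  | nil => exact .inr ⟨0, 0, 0, rfl⟩
  | cons l w ih =>
    obtain ⟨p, q, m, m', rfl, h⟩ | ⟨i, j, k, rfl⟩ := ih fun l hl => hw l (List.mem_cons_of_mem _ hl)
    · exact .inl ⟨l :: p, q, m, m', rfl, h⟩
    rcases hw l List.mem_cons_self with rfl | rfl | rfl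
    · exact .inr ⟨i + 1, j, k, rfl⟩
    · rcases i with _ | i
      · exact .inr ⟨0, j + 1, k, rfl⟩
      · exact .inl ⟨[], _, b, a, by simp [List.replicate_succ]; rfl, by decide⟩
    · rcases i with _ | i
      · rcases j with _ | j
        · exact .inr ⟨0, 0, k + 1, rfl⟩
        · exact .inl ⟨[], _, c, b, by simp [List.replicate_succ]; rfl, by decide⟩
      · exact .inl ⟨[], _, c, a, by simp [List.replicate_succ]; rfl, by decide⟩

/-- Soundness of the grammar: the languages `Sem` are closed under its rules, hence contain the
least family that is. -/
lemma LNonterminal.Sem.of_expands {r : ContextFreeRule Letter LNonterminal} (hr : r ∈ LRules)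
    {w : List Letter} (h : Expands LNonterminal.Sem r.output w) : r.input.Sem w := by
  have habc : IsABC a ∧ IsABC b ∧ IsABC c := by simp [IsABC]
  have hdesc : ∀ {l m : Letter}, IsABC l → IsABC m → rank m < rank l → ∀ {p q : List Letter},
      (∀ l ∈ p, IsABC l) → (∀ l ∈ q, IsABC l) → p ++ l :: m :: q ∈ L := by
    intro l m hl hm hlm p q hp hq
    refine ⟨fun k hk => ?_, notMem_K_of_rank_lt hlm p q⟩
    simp only [List.mem_append, List.mem_cons] at hk
    rcases hk with hk | rfl | rfl | hk
    exacts [hp _ hk, hl, hm, hq _ hk]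
  have hrep : ∀ {i j k : ℕ}, ¬ (i = j ∧ j = k) →
      List.replicate i a ++ List.replicate j b ++ List.replicate k c ∈ L := by
    intro i j k h
    refine ⟨fun l hl => ?_, fun h' => h (replicate_mem_K_iff.1 h')⟩
    simp only [List.mem_append, List.mem_replicate] at hl
    tauto
  have hsucc : ∀ {l m : Letter} {i j : ℕ}, i ≠ j →
      ∃ i' j', i' ≠ j' ∧ l :: (List.replicate i l ++ List.replicate j m ++ [m]) =
        List.replicate i' l ++ List.replicate j' m := by
    intro l m i j h
    exact ⟨i + 1, j + 1, by omega, by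
      rw [List.replicate_succ, List.replicate_succ' (n := j)]; simp⟩
  have hl : ∀ {l m : Letter} {i : ℕ}, ∃ i' j', i' ≠ j' ∧ l :: List.replicate i l =
        List.replicate i' l ++ List.replicate j' m :=
    fun {l m i} => ⟨i + 1, 0, by omega, by simp [List.replicate_succ]⟩
  have hm : ∀ {l m : Letter} {i : ℕ}, ∃ i' j', i' ≠ j' ∧ m :: List.replicate i m =
        List.replicate i' l ++ List.replicate j' m :=
    fun {l m i} => ⟨0, i + 1, by omega, by simp [List.replicate_succ]⟩
  have hs : ∀ {l : Letter} {i : ℕ}, ∃ i', l :: List.replicate i l = List.replicate i' l :=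
    fun {l i} => ⟨i + 1, rfl⟩
  have hall : ∀ {l : Letter} {w : List Letter}, IsABC l → (∀ l ∈ w, IsABC l) →
      ∀ l' ∈ l :: w, IsABC l' := by
    intro l w hl hw l' hl'
    rcases List.mem_cons.1 hl' with rfl | hl'
    exacts [hl, hw _ hl']
  fin_cases hr <;>
    simp only [Expands.nonterminal_cons_iff, Expands.terminal_cons_iff, Expands.nil_iff] at h
  · obtain ⟨p, hp, _, ⟨_, ⟨_, ⟨q, hq, _, rfl, rfl⟩, rfl⟩, rfl⟩, rfl⟩ := h
    rw [List.append_nil]; exact hdesc habc.2.1 habc.1 (by decide) hp hq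
  · obtain ⟨p, hp, _, ⟨_, ⟨_, ⟨q, hq, _, rfl, rfl⟩, rfl⟩, rfl⟩, rfl⟩ := h
    rw [List.append_nil]; exact hdesc habc.2.2 habc.1 (by decide) hp hq
  · obtain ⟨p, hp, _, ⟨_, ⟨_, ⟨q, hq, _, rfl, rfl⟩, rfl⟩, rfl⟩, rfl⟩ := h
    rw [List.append_nil]; exact hdesc habc.2.2 habc.2.1 (by decide) hp hq
  · obtain ⟨_, ⟨i, j, hij, rfl⟩, _, ⟨_, ⟨k, rfl⟩, _, rfl, rfl⟩, rfl⟩ := h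
    rw [List.append_nil]; exact hrep (i := i) (j := j) (k := k) (by omega)
  · obtain ⟨_, ⟨i, rfl⟩, _, ⟨_, ⟨j, k, hjk, rfl⟩, _, rfl, rfl⟩, rfl⟩ := h
    rw [List.append_nil, ← List.append_assoc]; exact hrep (i := i) (j := j) (k := k) (by omega)
  · obtain ⟨_, ⟨_, ⟨i, j, hij, rfl⟩, _, ⟨_, rfl, rfl⟩, rfl⟩, rfl⟩ := h
    exact hsucc hij
  · obtain ⟨_, ⟨_, ⟨i, rfl⟩, _, rfl, rfl⟩, rfl⟩ := h
    rw [List.append_nil]; exact hl (l := a) (m := b) (i := i)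
  · obtain ⟨_, ⟨_, ⟨i, rfl⟩, _, rfl, rfl⟩, rfl⟩ := h
    rw [List.append_nil]; exact hm (l := a) (m := b) (i := i)
  · obtain ⟨_, ⟨_, ⟨i, j, hij, rfl⟩, _, ⟨_, rfl, rfl⟩, rfl⟩, rfl⟩ := h
    exact hsucc hij
  · obtain ⟨_, ⟨_, ⟨i, rfl⟩, _, rfl, rfl⟩, rfl⟩ := h
    rw [List.append_nil]; exact hl (l := b) (m := c) (i := i)
  · obtain ⟨_, ⟨_, ⟨i, rfl⟩, _, rfl, rfl⟩, rfl⟩ := h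
    rw [List.append_nil]; exact hm (l := b) (m := c) (i := i)
  · exact ⟨0, h⟩
  · obtain ⟨_, ⟨_, ⟨i, rfl⟩, _, rfl, rfl⟩, rfl⟩ := h
    rw [List.append_nil]; exact hs (l := a) (i := i)
  · exact ⟨0, h⟩
  · obtain ⟨_, ⟨_, ⟨i, rfl⟩, _, rfl, rfl⟩, rfl⟩ := h
    rw [List.append_nil]; exact hs (l := b) (i := i)
  · exact ⟨0, h⟩
  · obtain ⟨_, ⟨_, ⟨i, rfl⟩, _, rfl, rfl⟩, rfl⟩ := h
    rw [List.append_nil]; exact hs (l := c) (i := i)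
  · rw [h]; exact fun _ h => absurd h List.not_mem_nil
  · obtain ⟨_, ⟨_, hw, _, rfl, rfl⟩, rfl⟩ := h
    rw [List.append_nil]; exact hall habc.1 hw
  · obtain ⟨_, ⟨_, hw, _, rfl, rfl⟩, rfl⟩ := h
    rw [List.append_nil]; exact hall habc.2.1 hw
  · obtain ⟨_, ⟨_, hw, _, rfl, rfl⟩, rfl⟩ := h
    rw [List.append_nil]; exact hall habc.2.2 hw

lemma LGrammar.yields {A : LNonterminal} {α : List (Symbol Letter LNonterminal)} {w : List Letter}
    (h : Expands (T := Letter) LGrammar.Yields α w)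
    (hr : (⟨A, α⟩ : ContextFreeRule Letter LNonterminal) ∈ LRules := by
      repeat first | exact List.Mem.head _ | apply List.Mem.tail) :
    LGrammar.Yields A w :=
  Yields.of_expands (g := LGrammar) (LGrammar.mem_rules.2 hr) h

lemma LGrammar.yields_star {l : Letter} (hl : IsABC l) (i : ℕ) :
    LGrammar.Yields (.star l) (List.replicate i l) := by
  induction i with
  | zero => rcases hl with rfl | rfl | rfl <;> exact yields .nil
  | succ i ih =>
    rw [List.replicate_succ, ← List.append_nil (List.replicate i l)]
    rcases hl with rfl | rfl | rfl <;> exact yields (.terminal _ (.nonterminal ih .nil))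

lemma LGrammar.yields_ne {l m : Letter} (h : l = a ∧ m = b ∨ l = b ∧ m = c) {i j : ℕ}
    (hij : i ≠ j) :
    LGrammar.Yields (.ne l m) (List.replicate i l ++ List.replicate j m) := by
  have hl : IsABC l := by unfold IsABC; tauto
  have hm : IsABC m := by unfold IsABC; tauto
  induction i generalizing j with
  | zero =>
    obtain ⟨j, rfl⟩ := Nat.exists_eq_succ_of_ne_zero hij.symm
    have := yields_star hm j
    rw [List.replicate_zero, List.nil_append, List.replicate_succ,
      ← List.append_nil (List.replicate j m)]
    rcases h with ⟨rfl, rfl⟩ | ⟨rfl, rfl⟩ <;> exact yields (.terminal _ (.nonterminal this .nil))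
  | succ i ih =>
    rcases j with _ | j
    · have := yields_star hl i
      rw [List.replicate_zero, List.replicate_succ, List.cons_append]
      rcases h with ⟨rfl, rfl⟩ | ⟨rfl, rfl⟩ <;> exact yields (.terminal _ (.nonterminal this .nil))
    · have := ih (j := j) (by omega)
      rw [List.replicate_succ, List.replicate_succ', List.cons_append, ← List.append_assoc]
      rcases h with ⟨rfl, rfl⟩ | ⟨rfl, rfl⟩ <;>
        exact yields (.terminal _ (.nonterminal this (.terminal _ .nil)))

lemma LGrammar.yields_all {w : List Letter} (hw : ∀ l ∈ w, IsABC l) :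
    LGrammar.Yields .all w := by
  induction w with
  | nil => exact yields .nil
  | cons l w ih =>
    have := ih fun l hl => hw l (List.mem_cons_of_mem _ hl)
    rw [← List.append_nil w]
    rcases hw l List.mem_cons_self with rfl | rfl | rfl <;>
      exact yields (.terminal _ (.nonterminal this .nil))

lemma LGrammar.yields_word {w : List Letter} (hw : w ∈ L) : LGrammar.Yields .word w := by
  obtain ⟨hw, hK⟩ := hw
  obtain ⟨p, q, l, m, rfl, h⟩ | ⟨i, j, k, rfl⟩ := exists_descent_or_eq_replicate hw
  · have hp := yields_all (w := p) fun l hl => hw l (by simp [hl])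
    have hq := yields_all (w := q) fun l hl => hw l (by simp [hl])
    have hl := hw l (by simp)
    have hm := hw m (by simp)
    rw [← List.append_nil q]
    rcases hl with rfl | rfl | rfl <;> rcases hm with rfl | rfl | rfl <;> simp only [rank] at h <;>
      first
      | omega
      | exact yields (.nonterminal hp (.terminal _ (.terminal _ (.nonterminal hq .nil))))
  · rw [replicate_mem_K_iff, not_and_or] at hK
    rcases hK with h | h
    · rw [← List.append_nil (List.replicate k c)]
      exact yields (.nonterminal (yields_ne (by simp) h)
        (.nonterminal (yields_star (by simp [IsABC]) k) .nil))
    · rw [List.append_assoc, ← List.append_nil (List.replicate j b ++ _)]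
      exact yields (.nonterminal (yields_star (by simp [IsABC]) i)
        (.nonterminal (yields_ne (by simp) h) .nil))

theorem isContextFree_L : L.IsContextFree :=
  ⟨LGrammar, Set.ext fun _ => ⟨fun h => Yields.induction (g := LGrammar) (Y := LNonterminal.Sem)
    (fun _ hr _ h => .of_expands (LGrammar.mem_rules.1 hr) h) h, LGrammar.yields_word⟩⟩

end CFWordProblem

/-! ### Evaluation of words in `M` -/

namespace CFWordProblem

open Letter ContextFreeGrammar

section Eval

universe u v

variable {B : Type v} {N : Type u} [Monoid N] (f : B → N)

@[simp] lemma eval_nil : eval f [] = 1 := rfl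

@[simp] lemma eval_cons (b : B) (w : List B) : eval f (b :: w) = f b * eval f w := by
  simp [eval]

@[simp] lemma eval_append (v w : List B) : eval f (v ++ w) = eval f v * eval f w := by
  simp [eval]

lemma eval_flatMap {A : Type*} {g : A → N} {h : B → List A} (hh : ∀ b, eval g (h b) = f b)
    (w : List B) : eval g (w.flatMap h) = eval f w := by
  induction w with
  | nil => rfl
  | cons b w ih => simp [hh, ih]

end Eval

lemma eval_of_eq_mk (w : List Letter) :
    eval (PresentedMonoid.of rels) w = PresentedMonoid.mk rels (FreeMonoid.ofList w) := by
  induction w with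
  | nil => rfl
  | cons l w ih => rw [eval_cons, ih, FreeMonoid.ofList_cons, map_mul]; rfl

lemma exists_eval_eq (m : M) : ∃ w, eval (PresentedMonoid.of rels) w = m := by
  obtain ⟨w, rfl⟩ := PresentedMonoid.surjective_mk m
  exact ⟨w.toList, eval_of_eq_mk _⟩

lemma eval_contract {w : List Letter} (hw : w ∈ L) (p : List Letter) :
    eval (PresentedMonoid.of rels) (x :: (w ++ y :: p)) =
      eval (PresentedMonoid.of rels) (z :: p) := by
  have h : eval (PresentedMonoid.of rels) (x :: (w ++ [y])) =
      eval (PresentedMonoid.of rels) [z] := by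
    rw [eval_of_eq_mk, eval_of_eq_mk]
    exact PresentedMonoid.mk_eq_mk_of_rel ⟨w, hw, rfl, rfl⟩
  rw [show x :: (w ++ y :: p) = x :: (w ++ [y]) ++ p by simp, eval_append, h, ← eval_append]
  rfl

lemma notMem_of_isABC {w : List Letter} (hw : ∀ l ∈ w, IsABC l) :
    x ∉ w ∧ y ∉ w ∧ z ∉ w := by
  refine ⟨fun h => ?_, fun h => ?_, fun h => ?_⟩ <;> simpa [IsABC] using hw _ h

lemma append_cons_inj_of_notMem {A : Type*} {k : A} {v w s t : List A} (hv : k ∉ v) (hw : k ∉ w)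
    (h : v ++ k :: s = w ++ k :: t) : v = w ∧ s = t := by
  induction v generalizing w with
  | nil =>
    cases w with
    | nil => exact ⟨rfl, (List.cons.inj h).2⟩
    | cons m w => exact absurd (List.cons.inj h).1 fun e => hw (e ▸ List.mem_cons_self)
  | cons l v ih =>
    cases w with
    | nil => exact absurd (List.cons.inj h).1 fun e => hv (e ▸ List.mem_cons_self)
    | cons m w =>
      obtain ⟨rfl, h'⟩ := List.cons.inj h
      obtain ⟨rfl, h''⟩ := ih (fun h => hv (List.mem_cons_of_mem _ h))
        (fun h => hw (List.mem_cons_of_mem _ h)) h'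
      exact ⟨rfl, h''⟩

/-! ### Normal forms and reductions -/

section NormalForm

open Classical in
/-- The normal form of `l :: t`, where `t` is in normal form. -/
noncomputable def step (l : Letter) (t : List Letter) : List Letter :=
  if h : l = x ∧ ∃ t', ∃ w ∈ L, t = w ++ y :: t' then z :: h.2.choose else l :: t

/-- The remainder chosen by `step` is unambiguous: words of `L` contain no `y`, so the first `y`
marks the cut. -/
lemma step_contract {w : List Letter} (hw : w ∈ L) (t : List Letter) :
    step x (w ++ y :: t) = z :: t := by
  have h : ∃ t', ∃ w' ∈ L, w ++ y :: t = w' ++ y :: t' := ⟨t, w, hw, rfl⟩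
  rw [step, dif_pos ⟨rfl, h⟩]
  obtain ⟨w', hw', e⟩ := h.choose_spec
  exact congrArg _ (append_cons_inj_of_notMem (notMem_of_isABC hw.1).2.1
    (notMem_of_isABC hw'.1).2.1 e).2.symm

lemma step_of_ne {l : Letter} (hl : l ≠ x) (t : List Letter) : step l t = l :: t :=
  dif_neg fun h => hl h.1

lemma step_eq_or (l : Letter) (t : List Letter) : step l t = l :: t ∨
    l = x ∧ ∃ t', ∃ w ∈ L, t = w ++ y :: t' ∧ step l t = z :: t' := by
  by_cases h : l = x ∧ ∃ t', ∃ w ∈ L, t = w ++ y :: t'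
  · obtain ⟨rfl, t', w, hw, rfl⟩ := h
    exact .inr ⟨rfl, t', w, hw, rfl, step_contract hw t'⟩
  · exact .inl (dif_neg h)

lemma foldr_step_of_notMem {w : List Letter} (hw : x ∉ w) (t : List Letter) :
    w.foldr step t = w ++ t := by
  induction w with
  | nil => rfl
  | cons l w ih =>
    rw [List.mem_cons, not_or] at hw
    rw [List.foldr_cons, ih hw.2, step_of_ne (Ne.symm hw.1)]
    rfl

/-- The normal form of a word. -/
noncomputable def normalForm (w : List Letter) : List Letter := w.foldr step []

/-- The action of `M` on words by multiplication and reduction. -/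
noncomputable def action : M →* Function.End (List Letter) :=
  PresentedMonoid.lift (rels := rels) (M := Function.End (List Letter)) step (by
    have h : ∀ (w : List Letter) (t : List Letter),
        (FreeMonoid.lift (M := Function.End (List Letter)) step (FreeMonoid.ofList w)) t =
          w.foldr step t := by
      intro w t
      induction w with
      | nil => rfl
      | cons l w ih =>
        rw [FreeMonoid.ofList_cons, map_mul, List.foldr_cons, ← ih]
        rfl
    rintro _ _ ⟨w, hw, rfl, rfl⟩
    funext t
    -- Both sides of a relation prepend `z` to every word `t`, in normal form or not.
    rw [← FreeMonoid.ofList_singleton, h, h, List.foldr_cons, foldr_step_of_notMem]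
    · simpa [step_of_ne] using step_contract hw t
    · simpa using (notMem_of_isABC hw.1).1)

lemma action_eval (w t : List Letter) :
    action (eval (PresentedMonoid.of rels) w) t = w.foldr step t := by
  induction w with
  | nil => simp; rfl
  | cons l w ih => rw [eval_cons, map_mul, List.foldr_cons, ← ih]; rfl

lemma normalForm_eq_of_eval_eq {p q : List Letter}
    (h : eval (PresentedMonoid.of rels) p = eval (PresentedMonoid.of rels) q) :
    normalForm p = normalForm q := by
  rw [normalForm, normalForm, ← action_eval, ← action_eval, h]

/-- The word `s` arises from `p` by replacing factors `xwy`, where `w ∈ L`, by `z`. -/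
inductive Reduces : List Letter → List Letter → Prop
  | nil : Reduces [] []
  | cons (l : Letter) {p s : List Letter} (h : Reduces p s) : Reduces (l :: p) (l :: s)
  | contract {w : List Letter} (hw : w ∈ L) {p s : List Letter} (h : Reduces p s) :
      Reduces (x :: (w ++ y :: p)) (z :: s)

/-- Each contraction leaves a `z`, so a `z`-free prefix of the result was copied unchanged. -/
lemma Reduces.of_append {w p s : List Letter} (hw : z ∉ w) (h : Reduces p (w ++ s)) :
    ∃ p', p = w ++ p' ∧ Reduces p' s := by
  induction w generalizing p with
  | nil => exact ⟨p, rfl, h⟩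
  | cons l w ih =>
    rw [List.mem_cons, not_or] at hw
    cases h with
    | cons _ h =>
      obtain ⟨p', rfl, h'⟩ := ih hw.2 h
      exact ⟨p', rfl, h'⟩
    | contract => exact absurd rfl hw.1

/-- A contraction at a new leading `x` consumes a prefix `wy` without `z`, which was therefore
already present in the original word. This is why a single pass suffices. -/
lemma reduces_normalForm (p : List Letter) : Reduces p (normalForm p) := by
  induction p with
  | nil => exact .nil
  | cons l p ih =>
    obtain e | ⟨rfl, t, w, hw, e, e'⟩ := step_eq_or l (normalForm p)
    · exact (show normalForm (l :: p) = _ from e) ▸ .cons l ih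
    · rw [show normalForm (x :: p) = z :: t from e']
      have hwy : z ∉ w ++ [y] := by simpa using (notMem_of_isABC hw.1).2.2
      obtain ⟨p, rfl, h⟩ := Reduces.of_append (s := t) hwy (by simpa using e ▸ ih)
      simpa using Reduces.contract hw h

/-- Since `w ∉ L`, the word `xwy` is its own normal form; as it contains no `z`, nothing else
reduces to it. -/
lemma eq_of_eval_eq {p w : List Letter} (hw : w ∈ K) (h : eval (PresentedMonoid.of rels) p =
    eval (PresentedMonoid.of rels) (x :: (w ++ [y]))) : p = x :: (w ++ [y]) := by
  have habc : ∀ l ∈ w, IsABC l := by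
    obtain ⟨n, rfl⟩ := hw
    intro l hl
    simp only [List.mem_append, List.mem_replicate] at hl
    unfold IsABC
    tauto
  obtain ⟨hx, hy, hz⟩ := notMem_of_isABC habc
  have e : normalForm (x :: (w ++ [y])) = x :: (w ++ [y]) := by
    rw [normalForm, List.foldr_cons, foldr_step_of_notMem (by simpa using hx), List.append_nil]
    obtain e | ⟨-, t, w', hw', e, -⟩ := step_eq_or x (w ++ [y])
    · exact e
    · have e := append_cons_inj_of_notMem hy (notMem_of_isABC hw'.1).2.1 e
      exact absurd hw (e.1 ▸ hw'.2)
  have hr := reduces_normalForm p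
  rw [normalForm_eq_of_eval_eq h, e, ← List.append_nil (x :: (w ++ [y]))] at hr
  obtain ⟨p', rfl, h'⟩ := hr.of_append (by simpa using hz)
  cases h'
  simp

end NormalForm

/-! ### The word problem as a substitution instance of a skeleton language -/

section WordProblem

instance : Finite Letter :=
  have : Fintype Letter := ⟨{a, b, c, x, y, z}, fun l => by cases l <;> decide⟩
  inferInstance

/-- Letters of a language from which the word problem of `M` is obtained by substitution: those of
the word problem, and two letters for the words of `L` and their reversals. -/
abbrev SkeletonLetter : Type := Option Letter ⊕ Bool

/-- The substitution that maps the skeleton onto the word problem of `M`. -/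
def skeletonSubst : SkeletonLetter → Language (Option Letter)
  | .inl t => {[t]}
  | .inr false => Language.map some L
  | .inr true => Language.map some L.reverse

/-- A letter of `M` as a symbol of the skeleton. -/
def letterSymbol (l : Letter) : Symbol SkeletonLetter Unit := .terminal (.inl (some l))

/-- The rules of a grammar for the skeleton. -/
def skeletonRules : List (ContextFreeRule SkeletonLetter Unit) :=
  ([a, b, c, x, y, z].map fun l => ⟨(), [letterSymbol l, .nonterminal (), letterSymbol l]⟩) ++
  [⟨(), [.terminal (.inl none)]⟩,
   ⟨(), [letterSymbol x, .terminal (.inr false), letterSymbol y, .nonterminal (), letterSymbol z]⟩,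
   ⟨(), [letterSymbol z, .nonterminal (), letterSymbol y, .terminal (.inr true), letterSymbol x]⟩,
   ⟨(), [letterSymbol x, .terminal (.inr false), letterSymbol y, .nonterminal (),
      letterSymbol y, .terminal (.inr true), letterSymbol x]⟩]

open Classical in
/-- A grammar for the skeleton. -/
noncomputable def skeletonGrammar : ContextFreeGrammar SkeletonLetter :=
  ⟨Unit, (), skeletonRules.toFinset⟩

lemma skeletonGrammar.mem_rules {r : ContextFreeRule SkeletonLetter Unit} :
    r ∈ skeletonGrammar.rules ↔ r ∈ skeletonRules := by
  classical exact List.mem_toFinset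

lemma mem_prod_append_iff {v v' : List SkeletonLetter} {w : List (Option Letter)} :
    w ∈ ((v ++ v').map skeletonSubst).prod ↔ ∃ w₁ w₂, w = w₁ ++ w₂ ∧
      w₁ ∈ (v.map skeletonSubst).prod ∧ w₂ ∈ (v'.map skeletonSubst).prod := by
  rw [List.map_append, List.prod_append]
  constructor
  · rintro ⟨w₁, h₁, w₂, h₂, rfl⟩
    exact ⟨w₁, w₂, rfl, h₁, h₂⟩
  · rintro ⟨w₁, w₂, rfl, h₁, h₂⟩
    exact ⟨w₁, h₁, w₂, h₂, rfl⟩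

lemma mem_prod_nil_iff {w : List (Option Letter)} :
    w ∈ (([] : List SkeletonLetter).map skeletonSubst).prod ↔ w = [] := Iff.rfl

lemma mem_prod_inl_iff {t : Option Letter} {v : List SkeletonLetter} {w : List (Option Letter)} :
    w ∈ ((.inl t :: v).map skeletonSubst).prod ↔
      ∃ w', w' ∈ (v.map skeletonSubst).prod ∧ w = t :: w' := by
  rw [List.map_cons, List.prod_cons]
  constructor
  · rintro ⟨_, rfl, w₂, h₂, rfl⟩
    exact ⟨w₂, h₂, rfl⟩
  · rintro ⟨w', h, rfl⟩
    exact ⟨[t], rfl, w', h, rfl⟩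

lemma mem_prod_false_iff {v : List SkeletonLetter} {w : List (Option Letter)} :
    w ∈ ((.inr false :: v).map skeletonSubst).prod ↔
      ∃ u ∈ L, ∃ w', w' ∈ (v.map skeletonSubst).prod ∧ w = u.map some ++ w' := by
  rw [List.map_cons, List.prod_cons]
  constructor
  · rintro ⟨_, ⟨u, hu, rfl⟩, w₂, h₂, rfl⟩
    exact ⟨u, hu, w₂, h₂, rfl⟩
  · rintro ⟨u, hu, w', h, rfl⟩
    exact ⟨_, ⟨u, hu, rfl⟩, w', h, rfl⟩

lemma mem_prod_true_iff {v : List SkeletonLetter} {w : List (Option Letter)} :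
    w ∈ ((.inr true :: v).map skeletonSubst).prod ↔
      ∃ u ∈ L, ∃ w', w' ∈ (v.map skeletonSubst).prod ∧ w = u.reverse.map some ++ w' := by
  rw [List.map_cons, List.prod_cons]
  constructor
  · rintro ⟨_, ⟨u, hu, rfl⟩, w₂, h₂, rfl⟩
    exact ⟨u.reverse, hu, w₂, h₂, by rw [List.reverse_reverse]⟩
  · rintro ⟨u, hu, w', h, rfl⟩
    exact ⟨_, ⟨u.reverse, by simpa [Language.reverse] using hu, rfl⟩, w', h, rfl⟩

/-- Soundness is stated for all substitution instances of a skeleton word at once, so that induction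
over the skeleton rules applies. -/
lemma mem_wordProblem_of_mem_subst {r : ContextFreeRule SkeletonLetter Unit}
    (hr : r ∈ skeletonRules) {v : List SkeletonLetter}
    (h : Expands (fun _ v => ∀ w ∈ (v.map skeletonSubst).prod,
      w ∈ wordProblem (PresentedMonoid.of rels)) r.output v) :
    ∀ w ∈ (v.map skeletonSubst).prod, w ∈ wordProblem (PresentedMonoid.of rels) := by
  intro w hw
  rw [skeletonRules, List.mem_append] at hr
  rcases hr with hr | hr
  · obtain ⟨l, -, rfl⟩ := List.mem_map.1 hr
    simp only [letterSymbol, Expands.nonterminal_cons_iff, Expands.terminal_cons_iff,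
      Expands.nil_iff] at h
    obtain ⟨_, ⟨v, hv, _, ⟨_, rfl, rfl⟩, rfl⟩, rfl⟩ := h
    simp only [mem_prod_inl_iff, mem_prod_append_iff, mem_prod_nil_iff] at hw
    obtain ⟨_, ⟨w, _, rfl, hw, ⟨_, rfl, rfl⟩⟩, rfl⟩ := hw
    obtain ⟨p, q, e, rfl⟩ := hv w hw
    exact ⟨l :: p, l :: q, by simp [e], by simp⟩
  · fin_cases hr <;> simp only [letterSymbol, Expands.nonterminal_cons_iff,
      Expands.terminal_cons_iff, Expands.nil_iff] at h
    · obtain ⟨_, rfl, rfl⟩ := h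
      simp only [mem_prod_inl_iff, mem_prod_nil_iff] at hw
      obtain ⟨_, rfl, rfl⟩ := hw
      exact ⟨[], [], rfl, rfl⟩
    · obtain ⟨_, ⟨_, ⟨_, ⟨v, hv, _, ⟨_, rfl, rfl⟩, rfl⟩, rfl⟩, rfl⟩, rfl⟩ := h
      simp only [mem_prod_inl_iff, mem_prod_false_iff, mem_prod_append_iff, mem_prod_nil_iff] at hw
      obtain ⟨_, ⟨u, hu, _, ⟨_, ⟨w, _, rfl, hw, ⟨_, rfl, rfl⟩⟩, rfl⟩, rfl⟩, rfl⟩ := hw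
      obtain ⟨p, q, e, rfl⟩ := hv w hw
      exact ⟨x :: (u ++ y :: p), z :: q, by rw [eval_contract hu, eval_cons, e, eval_cons],
        by simp⟩
    · obtain ⟨_, ⟨v, hv, _, ⟨_, ⟨_, ⟨_, rfl, rfl⟩, rfl⟩, rfl⟩, rfl⟩, rfl⟩ := h
      simp only [mem_prod_inl_iff, mem_prod_true_iff, mem_prod_append_iff, mem_prod_nil_iff] at hw
      obtain ⟨_, ⟨w, _, rfl, hw, ⟨_, ⟨u, hu, _, ⟨_, rfl, rfl⟩, rfl⟩, rfl⟩⟩, rfl⟩ := hw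
      obtain ⟨p, q, e, rfl⟩ := hv w hw
      exact ⟨z :: p, x :: (u ++ y :: q), by rw [eval_contract hu, eval_cons, e, eval_cons],
        by simp⟩
    · obtain ⟨_, ⟨_, ⟨_, ⟨v, hv, _, ⟨_, ⟨_, ⟨_, rfl, rfl⟩, rfl⟩, rfl⟩, rfl⟩, rfl⟩, rfl⟩, rfl⟩ := h
      simp only [mem_prod_inl_iff, mem_prod_true_iff, mem_prod_false_iff, mem_prod_append_iff,
        mem_prod_nil_iff] at hw
      obtain ⟨_, ⟨u, hu, _, ⟨_, ⟨w, _, rfl, hw, ⟨_, ⟨u', hu', _, ⟨_, rfl, rfl⟩, rfl⟩, rfl⟩⟩,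
        rfl⟩, rfl⟩, rfl⟩ := hw
      obtain ⟨p, q, e, rfl⟩ := hv w hw
      exact ⟨x :: (u ++ y :: p), x :: (u' ++ y :: q),
        by rw [eval_contract hu, eval_contract hu', eval_cons, e, eval_cons], by simp⟩

lemma skeletonGrammar.yields {α : List (Symbol SkeletonLetter Unit)} {v : List SkeletonLetter}
    (h : Expands (T := SkeletonLetter) skeletonGrammar.Yields α v)
    (hr : (⟨(), α⟩ : ContextFreeRule SkeletonLetter Unit) ∈ skeletonRules := by
      repeat first | exact List.Mem.head _ | apply List.Mem.tail) :
    skeletonGrammar.Yields () v :=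
  Yields.of_expands (g := skeletonGrammar) (skeletonGrammar.mem_rules.2 hr) h

/-- The first letter of the common reduct is copied or produced by a contraction, independently in
`p` and in `q`; each of the four combinations is a kind of skeleton rule. -/
lemma exists_mem_subst_of_reduces {p q s : List Letter} (hp : Reduces p s) (hq : Reduces q s) :
    ∃ v, skeletonGrammar.Yields () v ∧
      p.map some ++ none :: q.reverse.map some ∈ (v.map skeletonSubst).prod := by
  induction hp generalizing q with
  | nil =>
    cases hq
    exact ⟨_, skeletonGrammar.yields (.terminal _ .nil), by
      simp [mem_prod_inl_iff, -List.map_cons]⟩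
  | cons l hp ih =>
    cases hq with
    | cons _ hq =>
      obtain ⟨v, hv, h⟩ := ih hq
      refine ⟨_, skeletonGrammar.yields (α := [letterSymbol l, .nonterminal (), letterSymbol l])
        (.terminal _ (.nonterminal hv (.terminal _ .nil)))
        (by cases l <;> repeat first | exact List.Mem.head _ | apply List.Mem.tail), ?_⟩
      simp only [mem_prod_inl_iff, mem_prod_append_iff, mem_prod_nil_iff]
      exact ⟨_, ⟨_, _, rfl, h, _, rfl, rfl⟩, by simp⟩
    | @contract w hw _ _ hq =>
      obtain ⟨v, hv, h⟩ := ih hq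
      refine ⟨_, skeletonGrammar.yields (.terminal _ (.nonterminal hv (.terminal _
        (.terminal (.inr true) (.terminal _ .nil))))), ?_⟩
      simp only [mem_prod_inl_iff, mem_prod_true_iff, mem_prod_append_iff, mem_prod_nil_iff]
      exact ⟨_, ⟨_, _, rfl, h, _, ⟨w, hw, _, ⟨_, rfl, rfl⟩, rfl⟩, rfl⟩, by simp⟩
  | @contract w hw _ _ hp ih =>
    cases hq with
    | cons _ hq =>
      obtain ⟨v, hv, h⟩ := ih hq
      refine ⟨_, skeletonGrammar.yields (.terminal _ (.terminal (.inr false) (.terminal _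
        (.nonterminal hv (.terminal _ .nil))))), ?_⟩
      simp only [mem_prod_inl_iff, mem_prod_false_iff, mem_prod_append_iff, mem_prod_nil_iff]
      exact ⟨_, ⟨w, hw, _, ⟨_, ⟨_, _, rfl, h, _, rfl, rfl⟩, rfl⟩, rfl⟩, by simp⟩
    | @contract w' hw' _ _ hq =>
      obtain ⟨v, hv, h⟩ := ih hq
      refine ⟨_, skeletonGrammar.yields (.terminal _ (.terminal (.inr false) (.terminal _
        (.nonterminal hv (.terminal _ (.terminal (.inr true) (.terminal _ .nil))))))), ?_⟩
      simp only [mem_prod_inl_iff, mem_prod_false_iff, mem_prod_true_iff, mem_prod_append_iff,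
        mem_prod_nil_iff]
      exact ⟨_, ⟨w, hw, _, ⟨_, ⟨_, _, rfl, h, _, ⟨w', hw', _, ⟨_, rfl, rfl⟩, rfl⟩, rfl⟩, rfl⟩,
        rfl⟩, by simp⟩

theorem isContextFree_wordProblem : (wordProblem (PresentedMonoid.of rels)).IsContextFree := by
  have hσ : ∀ s, (skeletonSubst s).IsContextFree
    | .inl _ => Language.isContextFree_singleton _
    | .inr false => isContextFree_L.map some
    | .inr true => isContextFree_L.reverse.map some
  suffices h : wordProblem (PresentedMonoid.of rels) =
      ({w | ∃ v ∈ skeletonGrammar.language, w ∈ (v.map skeletonSubst).prod} :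
        Language (Option Letter)) by
    rw [h]
    exact Language.IsContextFree.subst ⟨skeletonGrammar, rfl⟩ hσ
  refine Set.ext fun w => ⟨?_, ?_⟩
  · rintro ⟨p, q, h, rfl⟩
    exact exists_mem_subst_of_reduces (reduces_normalForm p)
      (normalForm_eq_of_eval_eq h ▸ reduces_normalForm q)
  · rintro ⟨v, hv, hw⟩
    exact Yields.induction (g := skeletonGrammar) (Y := fun _ v => ∀ w ∈ (v.map skeletonSubst).prod,
      w ∈ wordProblem (PresentedMonoid.of rels))
      (fun r hr v h => mem_wordProblem_of_mem_subst (skeletonGrammar.mem_rules.1 hr) h) hv w hw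

end WordProblem

/-! ### No context-free cross-section -/

section CrossSection

/-- Transitions of an automaton that accepts the words `xwy` with `w ∈ {a, b, c}*`. -/
def scan : Fin 4 → Letter → Fin 4
  -- State 0 is initial, 1 reads the middle word, 2 accepts and 3 is a sink.
  | 0, x => 1
  | 1, a => 1
  | 1, b => 1
  | 1, c => 1
  | 1, y => 2
  | _, _ => 3

lemma foldl_scan_three (w : List Letter) : w.foldl scan 3 = 3 := by
  induction w with
  | nil => rfl
  | cons l w ih => cases l <;> exact ih

lemma eq_nil_of_foldl_scan_two {w : List Letter} (h : w.foldl scan 2 = 2) : w = [] := by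
  cases w with
  | nil => rfl
  | cons l w =>
    have : (l :: w).foldl scan 2 = 3 := by cases l <;> exact foldl_scan_three w
    simp [this] at h

lemma exists_eq_of_foldl_scan_one {w : List Letter} (h : w.foldl scan 1 = 2) :
    ∃ u, (∀ l ∈ u, IsABC l) ∧ w = u ++ [y] := by
  induction w with
  | nil => simp at h
  | cons l w ih =>
    have habc : IsABC l → w.foldl scan 1 = 2 → ∃ u, (∀ l ∈ u, IsABC l) ∧ l :: w = u ++ [y] := by
      intro hl h
      obtain ⟨u, hu, rfl⟩ := ih h
      exact ⟨l :: u, by simpa using ⟨hl, hu⟩, rfl⟩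
    have hbad : w.foldl scan 3 ≠ 2 := by simp [foldl_scan_three]
    cases l with
    | a => exact habc (by simp [IsABC]) h
    | b => exact habc (by simp [IsABC]) h
    | c => exact habc (by simp [IsABC]) h
    | x => exact absurd h hbad
    | y =>
      rw [eq_nil_of_foldl_scan_two (w := w) h]
      exact ⟨[], by simp, rfl⟩
    | z => exact absurd h hbad

lemma exists_eq_of_foldl_scan_zero {w : List Letter} (h : w.foldl scan 0 = 2) :
    ∃ u, (∀ l ∈ u, IsABC l) ∧ w = x :: (u ++ [y]) := by
  cases w with
  | nil => simp at h
  | cons l w =>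
    have hbad : w.foldl scan 3 ≠ 2 := by simp [foldl_scan_three]
    cases l with
    | x =>
      obtain ⟨u, hu, rfl⟩ := exists_eq_of_foldl_scan_one (w := w) h
      exact ⟨u, hu, rfl⟩
    | _ => exact absurd h hbad

lemma foldl_scan_of_mem_K {w : List Letter} (hw : w ∈ K) :
    (x :: (w ++ [y])).foldl scan 0 = 2 := by
  obtain ⟨n, rfl⟩ := hw
  have h : ∀ l, IsABC l → (List.replicate n l).foldl scan 1 = 1 := by
    intro l hl
    induction n with
    | zero => rfl
    | succ n ih => rcases hl with rfl | rfl | rfl <;> exact ih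
  have h₀ : scan 0 x = 1 := rfl
  have h₁ : scan 1 y = 2 := rfl
  simp [h₀, h₁, h a (by simp [IsABC]), h b (by simp [IsABC]), h c (by simp [IsABC])]

/-- A factor meeting both the `a`-block and the `c`-block would contain all of `bⁿ`. -/
lemma count_eq_zero_of_length_lt {n : ℕ} {U V T : List Letter} (hV : V.length < n)
    (h : U ++ V ++ T = x :: (List.replicate n a ++ List.replicate n b ++ List.replicate n c ++ [y])) :
    V.count a = 0 ∨ V.count c = 0 := by
  have h₁ : U ++ (V ++ T) = (x :: List.replicate n a) ++
      (List.replicate n b ++ List.replicate n c ++ [y]) := by simpa using h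
  have h₂ : (U ++ V) ++ T = (x :: (List.replicate n a ++ List.replicate n b)) ++
      (List.replicate n c ++ [y]) := by simpa using h
  rcases List.append_eq_append_iff.1 h₁ with ⟨U', e₁, -⟩ | ⟨U', -, e₁⟩
  · rcases List.append_eq_append_iff.1 h₂ with ⟨V', e₂, -⟩ | ⟨V', e₂, -⟩
    · have := congrArg (List.count c) e₂
      simp [List.count_replicate] at this
      omega
    · have e₃ := congrArg List.length e₁
      have e₄ := congrArg List.length e₂
      simp at e₃ e₄
      omega
  · have := congrArg (List.count a) e₁
    simp [List.count_replicate] at this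
    omega

theorem not_hasContextFreeCrossSection : ¬ HasContextFreeCrossSection M := by
  rintro ⟨B, _, f, -, J, ⟨g, rfl⟩, hJ⟩
  choose h hh using fun b => exists_eval_eq (f b)
  have hinj : ∀ W ∈ g.language, ∀ W' ∈ g.language, eval f W = eval f W' → W = W' :=
    fun W hW W' hW' e => (hJ (eval f W')).unique ⟨hW, e⟩ ⟨hW', rfl⟩
  obtain ⟨m, hm⟩ := (Set.finite_range fun b => (h b).length).bddAbove
  have hlen : ∀ W : List B, (W.flatMap h).length ≤ W.length * m := by
    intro W
    induction W with
    | nil => simp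
    | cons b W ih =>
      have := hm ⟨b, rfl⟩
      simp only [List.flatMap_cons, List.length_append, List.length_cons, add_mul] at this ⊢
      omega
  -- The invariant of a word over `B` is the transition map that its spelling induces on the four
  -- states.
  obtain ⟨p, hp⟩ := g.pumping_lemma fun W : List B => fun q => (W.flatMap h).foldl scan q
  -- Spellings of words of length at most `p` have length at most `p * m < n`: this forces `W` to be
  -- long and its pumped factor to be shorter than a block.
  set n := p * m + 1 with hn
  have hK : List.replicate n a ++ List.replicate n b ++ List.replicate n c ∈ K := ⟨n, rfl⟩
  obtain ⟨W, ⟨hW, he⟩, -⟩ := hJ (eval (PresentedMonoid.of rels)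
    (x :: (List.replicate n a ++ List.replicate n b ++ List.replicate n c ++ [y])))
  have hWh := eq_of_eval_eq hK ((eval_flatMap f hh W).trans he)
  have hpW : p < W.length := by
    by_contra! hlt
    have h₁ := hlen W
    have h₂ := Nat.mul_le_mul_right m hlt
    rw [hWh] at h₁
    simp at h₁
    omega
  obtain ⟨u, v, w, s, t, rfl, hvs, hle, hθ, hpump⟩ := hp W hW hpW
  have hθ' : ∀ q, ((v ++ w ++ s).flatMap h).foldl scan q = (w.flatMap h).foldl scan q :=
    fun q => congrFun hθ q
  have hscan : ((u ++ w ++ t).flatMap h).foldl scan 0 = 2 := by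
    rw [← foldl_scan_of_mem_K hK, ← hWh]
    simp only [List.flatMap_append, List.foldl_append] at hθ' ⊢
    rw [hθ']
  have hscan' : ((u ++ (v ++ v ++ w ++ s ++ s) ++ t).flatMap h).foldl scan 0 = 2 := by
    rw [← hscan]
    simp only [List.flatMap_append, List.foldl_append] at hθ' ⊢
    -- The inner `v w s` acts on states as `w`, and then so does the outer one.
    rw [hθ', hθ']
  have hlvs : 0 < v.length + s.length := by
    rw [← List.length_append]; exact List.length_pos_iff.2 hvs
  have hmem : u ++ w ++ t ∈ g.language := by simpa using hpump 0
  have hmem' : u ++ (v ++ v ++ w ++ s ++ s) ++ t ∈ g.language := by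
    simpa [List.replicate_succ] using hpump 2
  have hcount : ∃ l, (l = a ∨ l = c) ∧ ((v ++ w ++ s).flatMap h).count l = 0 := by
    have hlt : ((v ++ w ++ s).flatMap h).length < n :=
      ((hlen _).trans (Nat.mul_le_mul_right m hle)).trans_lt (Nat.lt_succ_self _)
    rcases count_eq_zero_of_length_lt (U := u.flatMap h) (T := t.flatMap h) hlt
      (by rw [← hWh]; simp) with h | h
    exacts [⟨a, .inl rfl, h⟩, ⟨c, .inr rfl, h⟩]
  obtain ⟨l, hl, hcl⟩ := hcount
  have hz : ∀ W' ∈ g.language, (W'.flatMap h).foldl scan 0 = 2 →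
      (W'.flatMap h).count l = ((u ++ (v ++ w ++ s) ++ t).flatMap h).count l →
      W' ≠ u ++ (v ++ w ++ s) ++ t → eval f W' = eval (PresentedMonoid.of rels) [z] := by
    intro W' hW' hs hc hne
    obtain ⟨r, hr, e⟩ := exists_eq_of_foldl_scan_zero hs
    by_cases hrK : r ∈ K
    · obtain ⟨k, rfl⟩ := hrK
      -- In a word of `K` the number of `a`s, or of `c`s, determines the exponent.
      have hk : k = n := by
        rw [e, hWh] at hc
        rcases hl with rfl | rfl <;> simpa [List.count_replicate] using hc
      refine absurd (hinj _ hW' _ hW ?_) hne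
      rw [← eval_flatMap f hh, ← eval_flatMap f hh, e, hWh, hk]
    · rw [← eval_flatMap f hh, e, eval_contract ⟨hr, hrK⟩]
  have hc : ∀ {α : List B}, (∀ b ∈ α, b ∈ v ++ w ++ s) → (α.flatMap h).count l = 0 := by
    intro α hα
    rw [List.count_eq_zero] at hcl ⊢
    intro hl
    obtain ⟨b, hb, hb'⟩ := List.mem_flatMap.1 hl
    exact hcl (List.mem_flatMap.2 ⟨b, hα b hb, hb'⟩)
  have hc' : ∀ {α : List B}, (∀ b ∈ α, b ∈ v ++ w ++ s) → ((u ++ α ++ t).flatMap h).count l =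
      (u.flatMap h).count l + (t.flatMap h).count l := by
    intro α hα
    rw [List.flatMap_append, List.flatMap_append, List.count_append, List.count_append, hc hα,
      add_zero]
  have e₀ := hz _ hmem hscan (by rw [hc' (by simp +contextual), hc' fun _ h => h]) fun e => by
      have := congrArg List.length e
      simp at this; omega
  have e₂ := hz _ hmem' hscan' (by
    rw [hc' (by simp only [List.mem_append]; tauto), hc' fun _ h => h]) fun e => by
      have := congrArg List.length e
      simp at this; omega
  -- Both pumped words represent `z`, so uniqueness identifies them, although their lengths differ
  -- by `2 * (v.length + s.length)`.
  have := congrArg List.length (hinj _ hmem _ hmem' (e₀.trans e₂.symm))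
  simp at this
  omega

end CrossSection

end CFWordProblem

theorem mainTheorem9 :
    (CFWordProblem.wordProblem (PresentedMonoid.of CFWordProblem.rels)).IsContextFree ∧
      ¬ CFWordProblem.HasContextFreeCrossSection CFWordProblem.M :=
  ⟨CFWordProblem.isContextFree_wordProblem, CFWordProblem.not_hasContextFreeCrossSection⟩
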